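/- Let $b>0$ and let $(p_k)_{k\ge 0}$ be a probability distribution on $\{0,1,2,\dots\}$ with mean $\mu:=\sum_{k\ge 0}k\,p_k<1$; put $m:=\mu-1$. Let $Z=(Z_t)_{t\ge 0}$ be the continuous-time (subcritical) Galton--Watson branching process with branching rate $b$ and offspring distribution $(p_k)$, started from one individual: a single ancestor is born at time $0$; every individual lives for an exponentially distributed time with rate $b$ and is replaced at its death by a random number of children, equal to $k$ with probability $p_k$; the lifetimes and the offspring numbers of all individuals are independent; and $Z_t$ is the number of individuals alive at time $t$. Then for all $\alpha>0$ and $T>0$, $$P\Big(\sup_{0\le s\le T}Z_s\ge\alpha\Big)\;\le\;\alpha^{-1}e^{-bmT}\,E\Big[Z_T;\ \sup_{0\le s\le T}Z_s\ge\alpha\Big],$$ where $E[Y;A]:=E[Y\,\mathbf 1_A]$. -/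

import Mathlib

open MeasureTheory ProbabilityTheory
open scoped ENNReal

/-! Individuals are labelled by finite words: `[]` is the single ancestor and `i :: u` is the
child number `i` (counted from `0`) of the individual `u`. For one realization, `L u` is the
lifetime of `u` and `X u` is the number of children that replace `u` when it dies. -/

namespace GaltonWatson

/-- The individual `u` is ever born: every word on its ancestral line is an actual child. -/
def IsBorn (X : List ℕ → ℕ) : List ℕ → Prop
  | [] => True
  | i :: u => i < X u ∧ IsBorn X u

/-- The birth time of `u`: the ancestor is born at time `0`, a child when its parent dies. -/
def birthTime (L : List ℕ → ℝ) : List ℕ → ℝ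
  | [] => 0
  | _ :: u => birthTime L u + L u

/-- The individuals that are alive at time `t`. -/
def aliveAt (L : List ℕ → ℝ) (X : List ℕ → ℕ) (t : ℝ) : Set (List ℕ) :=
  {u | IsBorn X u ∧ birthTime L u ≤ t ∧ t < birthTime L u + L u}

/-- The number of individuals alive at time `t` (infinite if there are infinitely many). -/
noncomputable def population (L : List ℕ → ℝ) (X : List ℕ → ℕ) (t : ℝ) : ℕ∞ :=
  (aliveAt L X t).encard

/-- All lifetimes are exponential with rate `b`, all numbers of children have law `p`, and all
these random variables are independent of each other. -/
structure IsGenealogy {Ω : Type*} [MeasurableSpace Ω] (P : Measure Ω) (b : ℝ) (p : PMF ℕ)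
    (L : List ℕ → Ω → ℝ) (X : List ℕ → Ω → ℕ) : Prop where
  measurable_lifetime : ∀ u, Measurable (L u)
  measurable_offspring : ∀ u, Measurable (X u)
  law_lifetime : ∀ u, P.map (L u) = expMeasure b
  law_offspring : ∀ u, P.map (X u) = p.toMeasure
  indep_lifetime_offspring : ∀ u, IndepFun (L u) (X u) P
  indep_individuals : iIndepFun (fun u ω => (L u ω, X u ω)) P

/-- `Z` is a continuous-time Galton–Watson process started from a single individual, with
branching rate `b` and offspring law `p`: it counts the individuals alive at each time. -/
def IsProcess {Ω : Type*} [MeasurableSpace Ω] (P : Measure Ω) (b : ℝ) (p : PMF ℕ)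
    (Z : ℝ → Ω → ℕ∞) : Prop :=
  ∃ (L : List ℕ → Ω → ℝ) (X : List ℕ → Ω → ℕ), IsGenealogy P b p L X ∧
    ∀ t, 0 ≤ t → ∀ ω, Z t ω = population (fun u => L u ω) (fun u => X u ω) t

/-- `sup_{0 ≤ s ≤ T} Z_s`. -/
noncomputable def runningSup {Ω : Type*} (Z : ℝ → Ω → ℕ∞) (T : ℝ) (ω : Ω) : ℝ≥0∞ :=
  ⨆ s ∈ Set.Icc (0 : ℝ) T, (Z s ω : ℝ≥0∞)

end GaltonWatson

namespace GaltonWatson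

/-! This is Doob's maximal inequality for $e^{-bmt}Z_t$, of which only the submartingale half is
needed: $E[Z_T;B]\ge e^{bm(T-s)}E[Z_s;B]$ when $B$ is the event that $s$ is the first time in a
finite grid at which level $\alpha$ is reached. On $B$ one has $Z_s\ge\alpha$, and
$e^{-bmT}e^{bm(T-s)}=e^{-bms}\ge 1$ because $m<0$. Summing over the disjoint events $B$ and
exhausting a countable set of times gives the claim.

The submartingale inequality (`IsGenealogy.mul_setLIntegral_population_le`) is proved individual by
individual, without a filtration or the Markov property. While `u` is alive at $s$, the history up
to $s$ is unchanged if `u` is made childless and longer-lived (`aliveAt_pruned`), so $B$ may be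
replaced by an event independent of `u` and its descendants. By memorylessness, deaths along a line
of descent form a Poisson process of rate $b$; hence the descendant of `u` reached by a word of
length $n$ is alive at $t$ with conditional probability equal to the chance of that line times the
Poisson probability of $n$ points in $t-s$ (`IsGenealogy.measure_alive_descendant`). Words of length
$n$ have total weight $\mu^n$, and the Poisson sum is $e^{b(\mu-1)(t-s)}$. All expectations are
extended nonnegative, so no integrability or non-explosion is required. -/

/-! ### Ancestry (suffixes of words) and pruning at an individual -/

theorem birthTime_add_lifetime_le {L : List ℕ → ℝ} (hL : ∀ x, 0 ≤ L x) {u v : List ℕ}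
    (h : u <:+ v) (hne : u ≠ v) : birthTime L u + L u ≤ birthTime L v := by
  induction v with
  | nil => exact absurd (List.suffix_nil.1 h) hne
  | cons i v ih =>
    rcases List.suffix_cons_iff.1 h with h | h
    · exact absurd h hne
    · by_cases huv : u = v
      · subst huv; exact le_rfl
      · have := ih h huv
        have := hL v
        simp only [birthTime]
        linarith

theorem ne_of_suffix_cons {x v : List ℕ} (i : ℕ) (h : x <:+ v) : x ≠ i :: v := by
  intro he
  have := h.length_le
  simp [he] at this

theorem birthTime_congr {L L' : List ℕ → ℝ} {v : List ℕ}
    (h : ∀ x, x <:+ v → x ≠ v → L x = L' x) : birthTime L v = birthTime L' v := by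
  induction v with
  | nil => rfl
  | cons i v ih =>
    have hs : v <:+ i :: v := List.suffix_cons i v
    simp only [birthTime]
    rw [ih fun x hx _ => h x (hx.trans hs) (ne_of_suffix_cons i hx),
      h v hs (ne_of_suffix_cons i List.suffix_rfl)]

theorem isBorn_congr {X X' : List ℕ → ℕ} {v : List ℕ}
    (h : ∀ x, x <:+ v → x ≠ v → X x = X' x) : IsBorn X v ↔ IsBorn X' v := by
  induction v with
  | nil => rfl
  | cons i v ih =>
    have hs : v <:+ i :: v := List.suffix_cons i v
    simp only [IsBorn]
    rw [ih fun x hx _ => h x (hx.trans hs) (ne_of_suffix_cons i hx),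
      h v hs (ne_of_suffix_cons i List.suffix_rfl)]

/-- Lifetimes of the tree in which `u` and all its potential descendants live for `c`. -/
def prunedLifetime (u : List ℕ) (c : ℝ) (L : List ℕ → ℝ) : List ℕ → ℝ :=
  fun x => if u <:+ x then c else L x

/-- Offspring numbers of the tree in which `u` has no descendants. -/
def prunedOffspring (u : List ℕ) (X : List ℕ → ℕ) : List ℕ → ℕ :=
  fun x => if u <:+ x then 0 else X x

theorem not_suffix_of_suffix_of_not_suffix {u v x : List ℕ} (h : x <:+ v) (hv : ¬ u <:+ v) :
    ¬ u <:+ x := fun hu => hv (hu.trans h)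

theorem not_suffix_of_suffix_of_ne {v x : List ℕ} (h : x <:+ v) (hv : x ≠ v) : ¬ v <:+ x :=
  fun hu => hv (h.eq_of_length (le_antisymm h.length_le hu.length_le))

/-- As long as `u` is alive, the population does not depend on the lifetime of `u` nor on its
descendants. -/
theorem aliveAt_pruned {L : List ℕ → ℝ} {X : List ℕ → ℕ} (hL : ∀ x, 0 ≤ L x) {u : List ℕ}
    {r s : ℝ} (hrs : r ≤ s) (hu : u ∈ aliveAt L X s) :
    aliveAt (prunedLifetime u (s + 1) L) (prunedOffspring u X) r = aliveAt L X r := by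
  -- Since births occur at nonnegative times, the lifetime `s + 1` keeps `u` alive beyond `s`.
  have h0 : 0 ≤ birthTime L u := by
    by_cases hu0 : u = []
    · simp [hu0, birthTime]
    · have := birthTime_add_lifetime_le hL (List.nil_suffix (l := u)) (Ne.symm hu0)
      have := hL []
      simp only [birthTime] at *
      linarith
  obtain ⟨hu1, hu2, hu3⟩ := hu
  ext v
  by_cases huv : u <:+ v
  · by_cases hne : u = v
    · subst hne
      have e1 : birthTime (prunedLifetime u (s + 1) L) u = birthTime L u :=
        birthTime_congr fun x hx hxu => if_neg (not_suffix_of_suffix_of_ne hx hxu)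
      have e2 : IsBorn (prunedOffspring u X) u ↔ IsBorn X u :=
        isBorn_congr fun x hx hxu => if_neg (not_suffix_of_suffix_of_ne hx hxu)
      have e3 : prunedLifetime u (s + 1) L u = s + 1 := if_pos List.suffix_rfl
      simp only [aliveAt, Set.mem_ofPred_eq, e1, e2, e3]
      constructor
      · rintro ⟨a, b, -⟩
        exact ⟨a, b, by linarith⟩
      · rintro ⟨a, b, -⟩
        exact ⟨a, b, by linarith⟩
    -- A proper descendant is never born in the pruned tree, and in the true tree only after `u`
    -- dies, hence after `s ≥ r`.
    · have hb := birthTime_add_lifetime_le hL huv hne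
      constructor
      · rintro ⟨a, -, -⟩
        cases v with
        | nil => exact absurd (List.suffix_nil.1 huv) hne
        | cons i v =>
          have hv : u <:+ v := (List.suffix_cons_iff.1 huv).resolve_left hne
          have := a.1
          simp [prunedOffspring, hv] at this
      · rintro ⟨-, b, -⟩
        linarith
  · have e1 : birthTime (prunedLifetime u (s + 1) L) v = birthTime L v :=
      birthTime_congr fun x hx _ => if_neg (not_suffix_of_suffix_of_not_suffix hx huv)
    have e2 : IsBorn (prunedOffspring u X) v ↔ IsBorn X v :=
      isBorn_congr fun x hx _ => if_neg (not_suffix_of_suffix_of_not_suffix hx huv)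
    have e3 : prunedLifetime u (s + 1) L v = L v := if_neg huv
    simp only [aliveAt, Set.mem_ofPred_eq, e1, e2, e3]

theorem coe_population_eq_tsum (L : List ℕ → ℝ) (X : List ℕ → ℕ) (t : ℝ) :
    (population L X t : ℝ≥0∞) = ∑' u, (aliveAt L X t).indicator 1 u := by
  rw [population, ← ENNReal.tsum_set_one, tsum_subtype (aliveAt L X t) fun _ => (1 : ℝ≥0∞)]
  rfl

/-- Every individual alive at time `t` descends from at most one individual alive at time `s`. -/
theorem tsum_descendants_le_population {L : List ℕ → ℝ} (X : List ℕ → ℕ) (hL : ∀ x, 0 ≤ L x)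
    (s t : ℝ) :
    ∑' u, ∑' w, (aliveAt L X s).indicator 1 u * (aliveAt L X t).indicator 1 (w ++ u) ≤
      (population L X t : ℝ≥0∞) := by
  have key : ∀ q : List ℕ × List ℕ, ((aliveAt L X s).indicator 1 q.1 *
      (aliveAt L X t).indicator 1 (q.2 ++ q.1) : ℝ≥0∞) =
      {q : List ℕ × List ℕ | q.1 ∈ aliveAt L X s ∧ q.2 ++ q.1 ∈ aliveAt L X t}.indicator
        (fun _ => 1) q := by
    intro q
    by_cases h1 : q.1 ∈ aliveAt L X s <;> by_cases h2 : q.2 ++ q.1 ∈ aliveAt L X t <;>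
      simp [h1, h2]
  rw [← ENNReal.tsum_prod (f := fun u w => (aliveAt L X s).indicator 1 u *
    (aliveAt L X t).indicator 1 (w ++ u)), tsum_congr key, ← tsum_subtype, ENNReal.tsum_set_one,
    population]
  refine ENat.toENNReal_le.2 (Set.encard_le_encard_of_injOn (f := fun q => q.2 ++ q.1)
    (fun q hq => hq.2) ?_)
  rintro ⟨u, w⟩ ⟨hu, -⟩ ⟨u', w'⟩ ⟨hu', -⟩ he
  simp only at hu hu' he
  -- Two ancestors of one individual are comparable; if distinct, one dies no later than the other
  -- is born, so they cannot both be alive at `s`.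
  have huu : u = u' := by
    by_contra hne
    have h1 : u <:+ w ++ u := List.suffix_append w u
    have h2 : u' <:+ w ++ u := he ▸ List.suffix_append w' u'
    rcases List.suffix_or_suffix_of_suffix h1 h2 with h | h
    · have := birthTime_add_lifetime_le hL h hne
      linarith [hu.2.2, hu'.2.1]
    · have := birthTime_add_lifetime_le hL h (Ne.symm hne)
      linarith [hu'.2.2, hu.2.1]
  subst huu
  rw [List.append_cancel_right he]

/-! ### Reduction of the supremum to countably many times -/

theorem ofReal_le_population_iff (L : List ℕ → ℝ) (X : List ℕ → ℕ) (t α : ℝ) :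
    ENNReal.ofReal α ≤ (population L X t : ℝ≥0∞) ↔ (⌈α⌉₊ : ℕ∞) ≤ population L X t := by
  cases h : population L X t with
  | top => simp
  | coe k =>
    rw [Nat.cast_le, Nat.ceil_le, ENat.toENNReal_coe, ENNReal.ofReal_le_natCast]

/-- The population stays above any level that it has reached for a positive time. -/
theorem eventually_le_population {L : List ℕ → ℝ} {X : List ℕ → ℕ} {s : ℝ} {n : ℕ}
    (h : (n : ℕ∞) ≤ population L X s) :
    ∀ᶠ r in nhdsWithin s (Set.Ioi s), (n : ℕ∞) ≤ population L X r := by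
  obtain ⟨A, hA, hn⟩ := Set.exists_subset_encard_eq h
  have hfin : A.Finite := Set.finite_of_encard_eq_coe hn
  have : ∀ᶠ r in nhdsWithin s (Set.Ioi s), ∀ u ∈ A, u ∈ aliveAt L X r := by
    rw [Filter.eventually_all_finite hfin]
    intro u hu
    obtain ⟨h1, h2, h3⟩ := hA hu
    filter_upwards [self_mem_nhdsWithin, mem_nhdsWithin_of_mem_nhds (Iio_mem_nhds h3)] with r hr hr'
    exact ⟨h1, h2.trans (le_of_lt hr), hr'⟩
  filter_upwards [this] with r hr
  rw [← hn]
  exact Set.encard_le_encard hr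

/-- The rational times in `[0, T]`, and the endpoint `T`. -/
def gridTimes (T : ℝ) : Set ℝ := insert T (Set.range ((↑) : ℚ → ℝ) ∩ Set.Icc 0 T)

theorem countable_gridTimes (T : ℝ) : (gridTimes T).Countable :=
  ((Set.countable_range _).mono Set.inter_subset_left).insert T

theorem gridTimes_subset {T : ℝ} (hT : 0 ≤ T) : gridTimes T ⊆ Set.Icc 0 T :=
  Set.insert_subset ⟨hT, le_rfl⟩ Set.inter_subset_right

/-- An integer-valued supremum that reaches `α` does so at some time, and persistence to the right
moves that time to a rational one. The endpoint `T` has no room on its right, which is why the grid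
contains it separately. -/
theorem ofReal_le_iSup_population_iff (L : List ℕ → ℝ) (X : List ℕ → ℕ) {α T : ℝ} (hα : 0 < α)
    (hT : 0 ≤ T) :
    ENNReal.ofReal α ≤ ⨆ s ∈ Set.Icc (0 : ℝ) T, (population L X s : ℝ≥0∞) ↔
      ∃ q ∈ gridTimes T, ENNReal.ofReal α ≤ (population L X q : ℝ≥0∞) := by
  constructor
  · intro h
    obtain ⟨s, hs, hsα⟩ : ∃ s ∈ Set.Icc (0 : ℝ) T, (⌈α⌉₊ : ℕ∞) ≤ population L X s := by
      by_contra! hc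
      have hpos : 0 < ⌈α⌉₊ := Nat.ceil_pos.2 hα
      have hle : ⨆ s ∈ Set.Icc (0 : ℝ) T, (population L X s : ℝ≥0∞) ≤ ((⌈α⌉₊ - 1 : ℕ) : ℝ≥0∞) := by
        refine iSup₂_le fun s hs => ?_
        have h1 := hc s hs
        cases hk : population L X s with
        | top => simp [hk] at h1
        | coe k =>
          rw [hk, Nat.cast_lt] at h1
          rw [ENat.toENNReal_coe, Nat.cast_le]
          omega
      have := (ENNReal.ofReal_le_natCast).1 (h.trans hle)
      have := Nat.ceil_le.2 this
      omega
    rcases hs.2.eq_or_lt with rfl | hlt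
    · exact ⟨s, Set.mem_insert _ _, (ofReal_le_population_iff L X s α).2 hsα⟩
    · obtain ⟨c, hc, hsub⟩ := (mem_nhdsGT_iff_exists_Ioo_subset).1 (eventually_le_population hsα)
      obtain ⟨q, hq1, hq2⟩ := exists_rat_btwn (lt_min hc hlt)
      refine ⟨q, Set.mem_insert_of_mem _ ⟨⟨q, rfl⟩, hs.1.trans hq1.le,
        hq2.le.trans (min_le_right _ _)⟩, (ofReal_le_population_iff L X q α).2 ?_⟩
      exact hsub ⟨hq1, hq2.trans_le (min_le_left _ _)⟩
  · rintro ⟨q, hq, hqα⟩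
    exact hqα.trans (le_iSup₂ (f := fun s (_ : s ∈ Set.Icc (0 : ℝ) T) =>
      (population L X s : ℝ≥0∞)) q (gridTimes_subset hT hq))

/-! ### Exponential lifetimes and Poisson weights -/

/-- The probability that a Poisson process of rate `b` has exactly `k` points in `[0, y]`, and `0`
for negative `y`. -/
noncomputable def poissonWeight (b : ℝ) (k : ℕ) (y : ℝ) : ℝ≥0∞ :=
  (Set.Ici (0 : ℝ)).indicator
    (fun y => ENNReal.ofReal ((b * y) ^ k / k.factorial * Real.exp (-(b * y)))) y

theorem measurable_poissonWeight (b : ℝ) (k : ℕ) : Measurable (poissonWeight b k) :=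
  Measurable.indicator (by fun_prop) measurableSet_Ici

theorem poissonWeight_of_nonneg {b : ℝ} {k : ℕ} {y : ℝ} (hy : 0 ≤ y) :
    poissonWeight b k y = ENNReal.ofReal ((b * y) ^ k / k.factorial * Real.exp (-(b * y))) :=
  Set.indicator_of_mem (Set.mem_Ici.2 hy) _

theorem poissonWeight_of_neg {b : ℝ} {k : ℕ} {y : ℝ} (hy : y < 0) : poissonWeight b k y = 0 :=
  Set.indicator_of_notMem (by simpa using hy) _

theorem expMeasure_Iio_zero (b : ℝ) : expMeasure b (Set.Iio 0) = 0 := by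
  rw [expMeasure, gammaMeasure, withDensity_apply _ measurableSet_Iio,
    setLIntegral_congr_fun measurableSet_Iio (g := fun _ => 0)
      (fun x hx => gammaPDF_of_neg hx), lintegral_zero]

theorem expMeasure_Ioi {b r : ℝ} (hb : 0 < b) (hr : 0 ≤ r) :
    expMeasure b (Set.Ioi r) = ENNReal.ofReal (Real.exp (-(b * r))) := by
  have := isProbabilityMeasure_expMeasure hb
  have hle : Real.exp (-(b * r)) ≤ 1 := Real.exp_le_one_iff.2 (by nlinarith)
  rw [← Set.compl_Iic, prob_compl_eq_one_sub measurableSet_Iic, ← ofReal_cdf, cdf_expMeasure_eq hb,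
    if_pos hr, ← ENNReal.ofReal_one, ← ENNReal.ofReal_sub _ (by linarith)]
  congr 1
  ring

theorem setLIntegral_Ioi_expMeasure {b r : ℝ} (hr : 0 ≤ r) {g : ℝ → ℝ≥0∞} (hg : Measurable g) :
    ∫⁻ x in Set.Ioi r, g x ∂expMeasure b =
      ∫⁻ x in Set.Ioi r, ENNReal.ofReal (b * Real.exp (-(b * x))) * g x := by
  rw [expMeasure, gammaMeasure,
    setLIntegral_withDensity_eq_setLIntegral_mul _ (f := gammaPDF 1 b)
      (measurable_exponentialPDFReal b).ennreal_ofReal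
      hg measurableSet_Ioi]
  refine setLIntegral_congr_fun measurableSet_Ioi fun x hx => ?_
  have hx0 : 0 ≤ x := hr.trans (le_of_lt hx)
  change exponentialPDF b x * g x = _
  rw [exponentialPDF_of_nonneg hx0]

/-- Memorylessness: the lifetime exceeds `r` with probability $e^{-br}$, and then its end followed
by `k` further points accounts for `k + 1` points in a span `c - r`. -/
theorem setLIntegral_poissonWeight_expMeasure {b r : ℝ} (hb : 0 < b) (hr : 0 ≤ r) (k : ℕ) (c : ℝ) :
    ∫⁻ x in Set.Ioi r, poissonWeight b k (c - x) ∂expMeasure b =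
      ENNReal.ofReal (Real.exp (-(b * r))) * poissonWeight b (k + 1) (c - r) := by
  rw [setLIntegral_Ioi_expMeasure hr (g := fun x => poissonWeight b k (c - x))
    ((measurable_poissonWeight b k).comp (by fun_prop))]
  rcases lt_or_ge c r with hcr | hcr
  · rw [poissonWeight_of_neg (by linarith), mul_zero,
      setLIntegral_congr_fun measurableSet_Ioi (g := fun _ => 0), lintegral_zero]
    intro x hx
    have : r < x := hx
    simp only
    rw [poissonWeight_of_neg (by linarith), mul_zero]
  · have hsplit : ∫⁻ x in Set.Ioi r, ENNReal.ofReal (b * Real.exp (-(b * x))) *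
          poissonWeight b k (c - x) =
        ∫⁻ x in Set.Ioc r c, ENNReal.ofReal
          (b ^ (k + 1) / k.factorial * Real.exp (-(b * c)) * (c - x) ^ k) := by
      rw [← lintegral_indicator measurableSet_Ioi, ← lintegral_indicator measurableSet_Ioc]
      refine lintegral_congr fun x => ?_
      by_cases h1 : r < x
      · rw [Set.indicator_of_mem (Set.mem_Ioi.2 h1)]
        by_cases h2 : x ≤ c
        · rw [Set.indicator_of_mem (Set.mem_Ioc.2 ⟨h1, h2⟩), poissonWeight_of_nonneg (by linarith),
            ← ENNReal.ofReal_mul (by positivity)]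
          congr 1
          have : Real.exp (-(b * c)) = Real.exp (-(b * x)) * Real.exp (-(b * (c - x))) := by
            rw [← Real.exp_add]; congr 1; ring
          rw [this, mul_pow]
          ring
        · rw [Set.indicator_of_notMem (fun h => h2 h.2), poissonWeight_of_neg (by linarith),
            mul_zero]
      · rw [Set.indicator_of_notMem (by simpa using h1),
          Set.indicator_of_notMem (fun h => h1 h.1)]
    have hint : ∫ x in Set.Ioc r c, b ^ (k + 1) / k.factorial * Real.exp (-(b * c)) * (c - x) ^ k =
        Real.exp (-(b * r)) * ((b * (c - r)) ^ (k + 1) / (k + 1).factorial *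
          Real.exp (-(b * (c - r)))) := by
      rw [← intervalIntegral.integral_of_le hcr, intervalIntegral.integral_const_mul,
        intervalIntegral.integral_comp_sub_left (fun x => x ^ k), integral_pow]
      have : Real.exp (-(b * c)) = Real.exp (-(b * r)) * Real.exp (-(b * (c - r))) := by
        rw [← Real.exp_add]; congr 1; ring
      rw [this, mul_pow, Nat.factorial_succ]
      push_cast
      field_simp
      simp
    rw [hsplit, ← ofReal_integral_eq_lintegral_ofReal, hint, poissonWeight_of_nonneg (by linarith),
      ENNReal.ofReal_mul (by positivity)]
    · exact (Continuous.integrableOn_Icc (by fun_prop)).mono_set Set.Ioc_subset_Icc_self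
    · filter_upwards [ae_restrict_mem measurableSet_Ioc] with x hx
      have : 0 ≤ c - x := by linarith [hx.2]
      positivity

theorem lintegral_poissonWeight_expMeasure {b : ℝ} (hb : 0 < b) (k : ℕ) (c : ℝ) :
    ∫⁻ x, poissonWeight b k (c - x) ∂expMeasure b = poissonWeight b (k + 1) c := by
  have h := setLIntegral_poissonWeight_expMeasure hb le_rfl k c
  have h0 : (expMeasure b).restrict (Set.Ioi 0) = expMeasure b := by
    refine Measure.restrict_eq_self_of_ae_mem ?_
    have := isProbabilityMeasure_expMeasure hb
    have h1 : expMeasure b (Set.Ioi 0) = 1 := by simp [expMeasure_Ioi hb le_rfl]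
    exact (mem_ae_iff_prob_eq_one measurableSet_Ioi).2 h1
  rw [h0] at h
  simpa using h

/-! ### Total weight of the lines of descent -/

/-- The probability that a word is realized as a line of descent. -/
noncomputable def lineWeight (p : PMF ℕ) : List ℕ → ℝ≥0∞
  | [] => 1
  | i :: w => p.toMeasure (Set.Ioi i) * lineWeight p w

/-- The tail-sum formula for the mean, by exchanging the two sums. -/
theorem tsum_toMeasure_Ioi {p : PMF ℕ} {μ : ℝ}
    (hμ : HasSum (fun k : ℕ => (k : ℝ) * (p k).toReal) μ) :
    ∑' i, p.toMeasure (Set.Ioi i) = ENNReal.ofReal μ := by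
  simp_rw [PMF.toMeasure_apply_eq_tsum]
  rw [ENNReal.tsum_comm, ← hμ.tsum_eq, ENNReal.ofReal_tsum_of_nonneg (fun k => by positivity)
    hμ.summable]
  refine tsum_congr fun k => ?_
  rw [ENNReal.ofReal_mul (by positivity), ENNReal.ofReal_toReal (p.apply_ne_top k),
    ENNReal.ofReal_natCast, tsum_eq_sum (s := Finset.range k)]
  · rw [Finset.sum_congr rfl (g := fun _ => p k)]
    · simp
    · intro i hi
      rw [Set.indicator_of_mem]
      simpa using hi
  · intro i hi
    rw [Set.indicator_of_notMem]
    simpa using hi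

theorem tsum_list_eq (f : List ℕ → ℝ≥0∞) : ∑' w, f w = f [] + ∑' i, ∑' w, f (i :: w) := by
  let e : Unit ⊕ (ℕ × List ℕ) ≃ List ℕ :=
    { toFun := Sum.elim (fun _ => []) fun q => q.1 :: q.2
      invFun := fun w => match w with
        | [] => Sum.inl ()
        | i :: w => Sum.inr (i, w)
      left_inv := by rintro (_ | ⟨i, w⟩) <;> rfl
      right_inv := by rintro (_ | ⟨i, w⟩) <;> rfl }
  rw [← e.tsum_eq, Summable.tsum_sum ENNReal.summable ENNReal.summable,
    ← ENNReal.tsum_prod (f := fun i w => f (i :: w)), tsum_fintype, Fintype.sum_unique]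
  rfl

theorem tsum_lineWeight_length (p : PMF ℕ) (n : ℕ) :
    ∑' w, lineWeight p w * {w : List ℕ | w.length = n}.indicator 1 w =
      (∑' i, p.toMeasure (Set.Ioi i)) ^ n := by
  induction n with
  | zero =>
    rw [tsum_list_eq]
    simp [lineWeight]
  | succ n ih =>
    rw [tsum_list_eq, pow_succ', ← ih, ← ENNReal.tsum_mul_right]
    simp_rw [← ENNReal.tsum_mul_left]
    have h0 : ([] : List ℕ) ∉ {w : List ℕ | w.length = n + 1} := by simp
    rw [Set.indicator_of_notMem h0, mul_zero, zero_add]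
    refine tsum_congr fun i => tsum_congr fun w => ?_
    by_cases hw : w.length = n <;> simp [lineWeight, hw]

theorem tsum_lineWeight_mul (p : PMF ℕ) (a : ℕ → ℝ≥0∞) :
    ∑' w, lineWeight p w * a w.length = ∑' n, (∑' i, p.toMeasure (Set.Ioi i)) ^ n * a n := by
  simp_rw [← tsum_lineWeight_length, ← ENNReal.tsum_mul_right]
  rw [ENNReal.tsum_comm]
  refine tsum_congr fun w => ?_
  rw [tsum_eq_single w.length]
  · simp
  · intro n hn
    simp [Ne.symm hn]

/-- Grouping words by length yields the Poisson generating function at `μ`; this is the mean growth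
of the population over a time `y`. -/
theorem tsum_lineWeight_mul_poissonWeight {b : ℝ} (hb : 0 < b) {p : PMF ℕ} {μ : ℝ}
    (hμ : HasSum (fun k : ℕ => (k : ℝ) * (p k).toReal) μ) {y : ℝ} (hy : 0 ≤ y) :
    ∑' w, lineWeight p w * poissonWeight b w.length y =
      ENNReal.ofReal (Real.exp (b * (μ - 1) * y)) := by
  have hμ0 : 0 ≤ μ := hμ.nonneg fun k => by positivity
  have hs : HasSum (fun n : ℕ => μ ^ n * ((b * y) ^ n / n.factorial * Real.exp (-(b * y))))
      (Real.exp (b * (μ - 1) * y)) := by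
    have h := (NormedSpace.expSeries_div_hasSum_exp (𝔸 := ℝ) (μ * (b * y))).mul_right (Real.exp (-(b * y)))
    rw [← Real.exp_eq_exp_ℝ, ← Real.exp_add] at h
    rw [show b * (μ - 1) * y = μ * (b * y) + -(b * y) by ring]
    refine h.congr_fun fun n => ?_
    rw [mul_pow μ]
    ring
  rw [tsum_lineWeight_mul p fun n => poissonWeight b n y, tsum_toMeasure_Ioi hμ, ← hs.tsum_eq,
    ENNReal.ofReal_tsum_of_nonneg (fun n => by positivity) hs.summable]
  refine tsum_congr fun n => ?_
  rw [poissonWeight_of_nonneg hy, ENNReal.ofReal_mul (pow_nonneg hμ0 n), ENNReal.ofReal_pow hμ0]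

/-! ### Measurability, and the past of an individual -/

theorem measurable_birthTime {Ω : Type*} {mΩ : MeasurableSpace Ω} {L : List ℕ → Ω → ℝ}
    {v : List ℕ} (h : ∀ x, x <:+ v → x ≠ v → Measurable (L x)) :
    Measurable fun ω => birthTime (fun x => L x ω) v := by
  induction v with
  | nil => exact measurable_const
  | cons i v ih =>
    have hs : v <:+ i :: v := List.suffix_cons i v
    exact (ih fun x hx _ => h x (hx.trans hs) (ne_of_suffix_cons i hx)).add
      (h v hs (ne_of_suffix_cons i List.suffix_rfl))

theorem measurableSet_isBorn {Ω : Type*} {mΩ : MeasurableSpace Ω} {X : List ℕ → Ω → ℕ}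
    {v : List ℕ} (h : ∀ x, x <:+ v → x ≠ v → Measurable (X x)) :
    MeasurableSet {ω | IsBorn (fun x => X x ω) v} := by
  induction v with
  | nil => exact MeasurableSet.univ
  | cons i v ih =>
    have hs : v <:+ i :: v := List.suffix_cons i v
    exact (h v hs (ne_of_suffix_cons i List.suffix_rfl) measurableSet_Ioi).inter
      (ih fun x hx _ => h x (hx.trans hs) (ne_of_suffix_cons i hx))

theorem measurableSet_mem_aliveAt {Ω : Type*} {mΩ : MeasurableSpace Ω} {L : List ℕ → Ω → ℝ}
    {X : List ℕ → Ω → ℕ} (hL : ∀ x, Measurable (L x)) (hX : ∀ x, Measurable (X x)) (t : ℝ)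
    (u : List ℕ) :
    MeasurableSet {ω | u ∈ aliveAt (fun x => L x ω) (fun x => X x ω) t} := by
  have hb := measurable_birthTime (v := u) fun x _ _ => hL x
  exact (measurableSet_isBorn fun x _ _ => hX x).inter
    ((measurableSet_le hb measurable_const).inter
      (measurableSet_lt measurable_const (hb.add (hL u))))

theorem measurable_population {Ω : Type*} {mΩ : MeasurableSpace Ω} {L : List ℕ → Ω → ℝ}
    {X : List ℕ → Ω → ℕ} (hL : ∀ x, Measurable (L x)) (hX : ∀ x, Measurable (X x)) (t : ℝ) :
    Measurable fun ω => (population (fun x => L x ω) (fun x => X x ω) t : ℝ≥0∞) := by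
  simp_rw [coe_population_eq_tsum]
  refine Measurable.tsum fun u => ?_
  exact (measurable_const (a := (1 : ℝ≥0∞))).indicator (measurableSet_mem_aliveAt hL hX t u)

/-- The information carried by the individuals that are neither `v` nor descendants of `v`. -/
@[reducible] def pastOf {Ω : Type*} (L : List ℕ → Ω → ℝ) (X : List ℕ → Ω → ℕ) (v : List ℕ) :
    MeasurableSpace Ω :=
  ⨆ x ∈ {x : List ℕ | ¬ v <:+ x},
    MeasurableSpace.comap (fun ω => (L x ω, X x ω)) inferInstance

section PastOf

variable {Ω : Type*} {L : List ℕ → Ω → ℝ} {X : List ℕ → Ω → ℕ}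

theorem measurable_pastOf_pair {v x : List ℕ} (h : ¬ v <:+ x) :
    Measurable[pastOf L X v] fun ω => (L x ω, X x ω) := by
  rw [measurable_iff_comap_le]
  exact le_iSup₂ (f := fun x (_ : x ∈ {x : List ℕ | ¬ v <:+ x}) =>
    MeasurableSpace.comap (fun ω => (L x ω, X x ω)) inferInstance) x h

theorem measurable_pastOf_lifetime {v x : List ℕ} (h : ¬ v <:+ x) :
    Measurable[pastOf L X v] (L x) :=
  measurable_fst.comp (measurable_pastOf_pair h)

theorem measurable_pastOf_offspring {v x : List ℕ} (h : ¬ v <:+ x) :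
    Measurable[pastOf L X v] (X x) :=
  measurable_snd.comp (measurable_pastOf_pair h)

theorem measurable_pastOf_birthTime {u v : List ℕ} (h : u <:+ v) :
    Measurable[pastOf L X v] fun ω => birthTime (fun x => L x ω) u :=
  measurable_birthTime fun _ hx hxu => measurable_pastOf_lifetime fun hv =>
    not_suffix_of_suffix_of_ne hx hxu (h.trans hv)

theorem measurableSet_pastOf_isBorn {u v : List ℕ} (h : u <:+ v) :
    MeasurableSet[pastOf L X v] {ω | IsBorn (fun x => X x ω) u} :=
  measurableSet_isBorn fun _ hx hxu => measurable_pastOf_offspring fun hv =>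
    not_suffix_of_suffix_of_ne hx hxu (h.trans hv)

theorem pastOf_mono {u v : List ℕ} (h : u <:+ v) : pastOf L X u ≤ pastOf L X v :=
  biSup_mono fun _ hx hv => hx (h.trans hv)

/-- Pruning replaces the data of `u` and its descendants by constants, so only the past of `u`
enters. -/
theorem measurable_pastOf_population_pruned (u : List ℕ) (c r : ℝ) :
    Measurable[pastOf L X u] fun ω => (population (prunedLifetime u c fun x => L x ω)
      (prunedOffspring u fun x => X x ω) r : ℝ≥0∞) := by
  refine measurable_population (L := fun x ω => prunedLifetime u c (fun x => L x ω) x)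
    (X := fun x ω => prunedOffspring u (fun x => X x ω) x) (fun x => ?_) (fun x => ?_) r
  · by_cases hx : u <:+ x
    · simp only [prunedLifetime, hx, if_true]; exact measurable_const
    · simp only [prunedLifetime, hx, if_false]; exact measurable_pastOf_lifetime hx
  · by_cases hx : u <:+ x
    · simp only [prunedOffspring, hx, if_true]; exact measurable_const
    · simp only [prunedOffspring, hx, if_false]; exact measurable_pastOf_offspring hx

end PastOf

/-! ### Independence and the law of the descendants -/

section Genealogy

variable {Ω : Type*} [MeasurableSpace Ω] {P : Measure Ω} {b : ℝ} {p : PMF ℕ}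
  {L : List ℕ → Ω → ℝ} {X : List ℕ → Ω → ℕ}

theorem IsGenealogy.pastOf_le (h : IsGenealogy P b p L X) (v : List ℕ) :
    pastOf L X v ≤ ‹MeasurableSpace Ω› :=
  iSup₂_le fun x _ => ((h.measurable_lifetime x).prodMk (h.measurable_offspring x)).comap_le

theorem IsGenealogy.indep_pastOf (h : IsGenealogy P b p L X) (v : List ℕ) :
    Indep (pastOf L X v) (MeasurableSpace.comap (fun ω => (L v ω, X v ω)) inferInstance) P := by
  have hdisj : Disjoint {x : List ℕ | ¬ v <:+ x} {v} := by
    simp [List.suffix_rfl]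
  have := indep_iSup_of_disjoint
    (fun x => ((h.measurable_lifetime x).prodMk (h.measurable_offspring x)).comap_le)
    h.indep_individuals hdisj
  simpa [pastOf] using this

theorem IsGenealogy.ae_nonneg (h : IsGenealogy P b p L X) : ∀ᵐ ω ∂P, ∀ x, 0 ≤ L x ω := by
  rw [ae_all_iff]
  intro x
  have := expMeasure_Iio_zero b
  rw [← h.law_lifetime x, Measure.map_apply (h.measurable_lifetime x) measurableSet_Iio] at this
  rw [ae_iff]
  convert this using 2
  ext ω
  simp

theorem IsGenealogy.map_pair [IsProbabilityMeasure P] (h : IsGenealogy P b p L X) (v : List ℕ) :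
    P.map (fun ω => (L v ω, X v ω)) = (expMeasure b).prod p.toMeasure := by
  rw [(h.indep_lifetime_offspring v).map_prod_eq_prod_map_map
    (h.measurable_lifetime v).aemeasurable (h.measurable_offspring v).aemeasurable,
    h.law_lifetime, h.law_offspring]

/-- Integrating out the lifetime and the offspring number of the individual `v`. -/
theorem IsGenealogy.lintegral_eq [IsProbabilityMeasure P] (h : IsGenealogy P b p L X)
    (hb : 0 < b) (v : List ℕ) {ξ : Ω → ℝ≥0∞} (hξ : Measurable[pastOf L X v] ξ)
    (A : Set ℕ) {f : ℝ × ℝ → ℝ≥0∞} (hf : Measurable f) :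
    ∫⁻ ω, ξ ω * (A.indicator 1 (X v ω) * f (birthTime (fun x => L x ω) v, L v ω)) ∂P =
      p.toMeasure A * ∫⁻ ω, ξ ω * ∫⁻ x, f (birthTime (fun x => L x ω) v, x) ∂expMeasure b ∂P := by
  have := isProbabilityMeasure_expMeasure hb
  set β : Ω → ℝ := fun ω => birthTime (fun x => L x ω) v
  have hβ : Measurable[pastOf L X v] β := measurable_pastOf_birthTime List.suffix_rfl
  have hY : Measurable[pastOf L X v] fun ω => (ξ ω, β ω) := hξ.prodMk hβ
  have hY' : Measurable fun ω => (ξ ω, β ω) := hY.mono (h.pastOf_le v) le_rfl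
  have hV : Measurable fun ω => (L v ω, X v ω) :=
    (h.measurable_lifetime v).prodMk (h.measurable_offspring v)
  have hind : IndepFun (fun ω => (ξ ω, β ω)) (fun ω => (L v ω, X v ω)) P :=
    indep_of_indep_of_le_left (h.indep_pastOf v) (measurable_iff_comap_le.1 hY)
  have hmap := hind.map_prod_eq_prod_map_map hY'.aemeasurable hV.aemeasurable
  rw [h.map_pair v] at hmap
  have hA : Measurable fun n : ℕ => A.indicator (1 : ℕ → ℝ≥0∞) n := measurable_from_nat
  let g : (ℝ≥0∞ × ℝ) × (ℝ × ℕ) → ℝ≥0∞ := fun q => q.1.1 * (A.indicator 1 q.2.2 * f (q.1.2, q.2.1))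
  have hg : Measurable g := by
    have h1 : Measurable fun q : (ℝ≥0∞ × ℝ) × (ℝ × ℕ) => f (q.1.2, q.2.1) :=
      hf.comp (by fun_prop)
    have h2 : Measurable fun q : (ℝ≥0∞ × ℝ) × (ℝ × ℕ) => A.indicator (1 : ℕ → ℝ≥0∞) q.2.2 :=
      hA.comp (by fun_prop)
    exact (by fun_prop : Measurable fun q : (ℝ≥0∞ × ℝ) × (ℝ × ℕ) => q.1.1).mul (h2.mul h1)
  have hinner : ∀ y : ℝ≥0∞ × ℝ, ∫⁻ q, g (y, q) ∂(expMeasure b).prod p.toMeasure =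
      p.toMeasure A * (y.1 * ∫⁻ x, f (y.2, x) ∂expMeasure b) := by
    intro y
    have hf2 : Measurable fun x => f (y.2, x) := hf.comp (by fun_prop)
    have : ∀ q : ℝ × ℕ, g (y, q) = (y.1 * f (y.2, q.1)) * A.indicator 1 q.2 := by
      intro q
      simp only [g]
      ring
    simp_rw [this]
    rw [lintegral_prod_mul (f := fun x => y.1 * f (y.2, x)) (g := fun n => A.indicator 1 n)
      (hf2.const_mul _).aemeasurable hA.aemeasurable, lintegral_const_mul _ hf2, mul_comm]
    congr 1
    exact lintegral_indicator_one MeasurableSet.of_discrete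
  have hF : Measurable fun y : ℝ≥0∞ × ℝ => ∫⁻ x, f (y.2, x) ∂expMeasure b :=
    Measurable.lintegral_prod_right' (f := fun q : (ℝ≥0∞ × ℝ) × ℝ => f (q.1.2, q.2))
      (hf.comp (by fun_prop))
  have hG : Measurable fun y : ℝ≥0∞ × ℝ => y.1 * ∫⁻ x, f (y.2, x) ∂expMeasure b :=
    measurable_fst.mul hF
  calc ∫⁻ ω, ξ ω * (A.indicator 1 (X v ω) * f (β ω, L v ω)) ∂P
      = ∫⁻ ω, g ((ξ ω, β ω), (L v ω, X v ω)) ∂P := rfl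
    _ = ∫⁻ q, g q ∂P.map fun ω => ((ξ ω, β ω), (L v ω, X v ω)) :=
        (lintegral_map hg (hY'.prodMk hV)).symm
    _ = ∫⁻ y, ∫⁻ q, g (y, q) ∂(expMeasure b).prod p.toMeasure ∂P.map fun ω => (ξ ω, β ω) := by
        rw [hmap, lintegral_prod _ hg.aemeasurable]
    _ = ∫⁻ y, p.toMeasure A * (y.1 * ∫⁻ x, f (y.2, x) ∂expMeasure b) ∂P.map fun ω =>
          (ξ ω, β ω) := lintegral_congr hinner
    _ = p.toMeasure A * ∫⁻ ω, ξ ω * ∫⁻ x, f (β ω, x) ∂expMeasure b ∂P := by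
        rw [lintegral_const_mul _ hG, lintegral_map hG hY']

theorem IsGenealogy.lintegral_lifetime_eq [IsProbabilityMeasure P] (h : IsGenealogy P b p L X)
    (hb : 0 < b) (v : List ℕ) {ξ : Ω → ℝ≥0∞} (hξ : Measurable[pastOf L X v] ξ)
    {f : ℝ × ℝ → ℝ≥0∞} (hf : Measurable f) :
    ∫⁻ ω, ξ ω * f (birthTime (fun x => L x ω) v, L v ω) ∂P =
      ∫⁻ ω, ξ ω * ∫⁻ x, f (birthTime (fun x => L x ω) v, x) ∂expMeasure b ∂P := by
  simpa using h.lintegral_eq hb v hξ Set.univ hf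

theorem lintegral_alive_expMeasure (hb : 0 < b) (t β : ℝ) :
    ∫⁻ x, {q : ℝ × ℝ | q.1 ≤ t ∧ t < q.1 + q.2}.indicator 1 (β, x) ∂expMeasure b =
      poissonWeight b 0 (t - β) := by
  rcases le_or_gt β t with h | h
  · have : ∀ x, {q : ℝ × ℝ | q.1 ≤ t ∧ t < q.1 + q.2}.indicator (1 : ℝ × ℝ → ℝ≥0∞) (β, x) =
        (Set.Ioi (t - β)).indicator 1 x := by
      intro x
      by_cases hx : t < β + x
      · have : t - β < x := by linarith
        simp [hx, h, this]
      · have : ¬ t - β < x := fun h => hx (by linarith)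
        simp [hx, this]
    simp_rw [this]
    rw [lintegral_indicator_one measurableSet_Ioi, expMeasure_Ioi hb (by linarith),
      poissonWeight_of_nonneg (by linarith)]
    simp
  · have : ∀ x, {q : ℝ × ℝ | q.1 ≤ t ∧ t < q.1 + q.2}.indicator (1 : ℝ × ℝ → ℝ≥0∞) (β, x) = 0 := by
      intro x
      simp [not_le.2 h]
    simp_rw [this]
    rw [lintegral_zero, poissonWeight_of_neg (by linarith)]

theorem measurableSet_alive_prod (t : ℝ) :
    MeasurableSet {q : ℝ × ℝ | q.1 ≤ t ∧ t < q.1 + q.2} :=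
  (measurableSet_le measurable_fst measurable_const).inter
    (measurableSet_lt measurable_const (measurable_fst.add measurable_snd))

theorem poissonWeight_zero_sub {s t β : ℝ} (hβ : β ≤ s) (hst : s ≤ t) :
    poissonWeight b 0 (t - β) = poissonWeight b 0 (t - s) * poissonWeight b 0 (s - β) := by
  rw [poissonWeight_of_nonneg (by linarith), poissonWeight_of_nonneg (by linarith),
    poissonWeight_of_nonneg (by linarith), ← ENNReal.ofReal_mul (by positivity)]
  congr 1
  simp only [pow_zero, Nat.factorial_zero, Nat.cast_one, div_one, one_mul]
  rw [← Real.exp_add]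
  congr 1
  ring

/-- The event that `u` is alive at time `t` while an event `E` occurs. -/
def aliveEvent (L : List ℕ → Ω → ℝ) (X : List ℕ → Ω → ℕ) (E : Set Ω) (u : List ℕ) (t : ℝ) :
    Set Ω :=
  E ∩ {ω | u ∈ aliveAt (fun x => L x ω) (fun x => X x ω) t}

/-- Birth and birth time of `u` depend only on its proper ancestors, so the lifetime of `u` can be
integrated out alone. -/
theorem IsGenealogy.measure_aliveEvent [IsProbabilityMeasure P] (h : IsGenealogy P b p L X)
    (hb : 0 < b) {u : List ℕ} {E : Set Ω} (hE : MeasurableSet[pastOf L X u] E) (t : ℝ) :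
    P (aliveEvent L X E u t) =
      ∫⁻ ω, (E ∩ {ω | IsBorn (fun x => X x ω) u}).indicator 1 ω *
        poissonWeight b 0 (t - birthTime (fun x => L x ω) u) ∂P := by
  have hE' : MeasurableSet[pastOf L X u] (E ∩ {ω | IsBorn (fun x => X x ω) u}) :=
    hE.inter (measurableSet_pastOf_isBorn List.suffix_rfl)
  have key := h.lintegral_lifetime_eq hb u
    (ξ := (E ∩ {ω | IsBorn (fun x => X x ω) u}).indicator 1)
    ((@measurable_const _ _ _ (pastOf L X u) (1 : ℝ≥0∞)).indicator hE')
    (f := {q : ℝ × ℝ | q.1 ≤ t ∧ t < q.1 + q.2}.indicator 1)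
    (measurable_const.indicator (measurableSet_alive_prod t))
  simp_rw [lintegral_alive_expMeasure hb] at key
  classical
  rw [aliveEvent, ← key, ← lintegral_indicator_one ((h.pastOf_le u _ hE).inter
    (measurableSet_mem_aliveAt h.measurable_lifetime h.measurable_offspring t u))]
  refine lintegral_congr fun ω => ?_
  rw [Set.indicator_apply, Set.indicator_apply, Set.indicator_apply]
  simp only [aliveAt, Set.mem_inter_iff, Set.mem_ofPred_eq, Pi.one_apply]
  split_ifs <;> simp_all

theorem lintegral_alive_mul_poissonWeight (hb : 0 < b) (k : ℕ) {s t β : ℝ} :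
    ∫⁻ x, {q : ℝ × ℝ | q.1 ≤ s ∧ s < q.1 + q.2}.indicator
        (fun q => poissonWeight b k (t - (q.1 + q.2))) (β, x) ∂expMeasure b =
      poissonWeight b 0 (s - β) * poissonWeight b (k + 1) (t - s) := by
  rcases le_or_gt β s with h | h
  · have : ∀ x, {q : ℝ × ℝ | q.1 ≤ s ∧ s < q.1 + q.2}.indicator
        (fun q => poissonWeight b k (t - (q.1 + q.2))) (β, x) =
        (Set.Ioi (s - β)).indicator (fun x => poissonWeight b k (t - β - x)) x := by
      intro x
      by_cases hx : s < β + x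
      · have : s - β < x := by linarith
        simp [hx, h, this, sub_sub]
      · have : ¬ s - β < x := fun h => hx (by linarith)
        simp [hx, this]
    simp_rw [this]
    rw [lintegral_indicator measurableSet_Ioi,
      setLIntegral_poissonWeight_expMeasure hb (by linarith),
      poissonWeight_of_nonneg (k := 0) (by linarith)]
    simp
  · have : ∀ x, {q : ℝ × ℝ | q.1 ≤ s ∧ s < q.1 + q.2}.indicator
        (fun q => poissonWeight b k (t - (q.1 + q.2))) (β, x) = 0 := by
      intro x
      simp [not_le.2 h]
    simp_rw [this]
    rw [lintegral_zero, poissonWeight_of_neg (by linarith), zero_mul]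

/-- The expected weight of the descendant `i :: w` of `u`, on the event that `u` is alive at `s`. -/
theorem IsGenealogy.lintegral_descendant [IsProbabilityMeasure P] (h : IsGenealogy P b p L X)
    (hb : 0 < b) {u : List ℕ} {E : Set Ω} (hE : MeasurableSet[pastOf L X u] E)
    (s t : ℝ) (w : List ℕ) (i k : ℕ) :
    ∫⁻ ω, (aliveEvent L X E u s ∩ {ω | IsBorn (fun x => X x ω) (i :: w ++ u)}).indicator 1 ω *
        poissonWeight b k (t - birthTime (fun x => L x ω) (i :: w ++ u)) ∂P =
      lineWeight p (i :: w) * poissonWeight b (k + (i :: w).length) (t - s) *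
        P (aliveEvent L X E u s) := by
  -- Integrating out a lifetime turns weight `k` at a child's birth into weight `k + 1` at its
  -- parent's, so `k` must stay free.
  induction w generalizing i k with
  | nil =>
    have hE' : MeasurableSet[pastOf L X u] (E ∩ {ω | IsBorn (fun x => X x ω) u}) :=
      hE.inter (measurableSet_pastOf_isBorn List.suffix_rfl)
    have hm : Measurable[pastOf L X u]
        ((E ∩ {ω | IsBorn (fun x => X x ω) u}).indicator (1 : Ω → ℝ≥0∞)) :=
      (@measurable_const _ _ _ (pastOf L X u) (1 : ℝ≥0∞)).indicator hE'
    have key := h.lintegral_eq hb u hm (Set.Ioi i)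
      (f := {q : ℝ × ℝ | q.1 ≤ s ∧ s < q.1 + q.2}.indicator
        (fun q => poissonWeight b k (t - (q.1 + q.2))))
      (((measurable_poissonWeight b k).comp (by fun_prop)).indicator (measurableSet_alive_prod s))
    simp_rw [lintegral_alive_mul_poissonWeight hb, ← mul_assoc] at key
    rw [lintegral_mul_const, ← h.measure_aliveEvent hb hE] at key
    · calc _ = _ := lintegral_congr fun ω => ?_
        _ = _ := key
        _ = _ := by simp only [lineWeight, List.length_cons, List.length_nil]; ring_nf
      classical
      simp only [List.cons_append, List.nil_append, Set.indicator_apply, aliveEvent, aliveAt,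
        Set.mem_inter_iff, Set.mem_ofPred_eq, Pi.one_apply, IsBorn, birthTime, Set.mem_Ioi]
      split_ifs <;> simp_all
    · exact (hm.mono (h.pastOf_le u) le_rfl).mul ((measurable_poissonWeight b 0).comp
        (((measurable_pastOf_birthTime List.suffix_rfl).mono (h.pastOf_le u) le_rfl).const_sub _))
  | cons j w ih =>
    set v := j :: w ++ u with hv
    have hsuf : u <:+ v := List.suffix_append _ _
    have hne : ¬ v <:+ u := fun hvu => by
      have := hvu.length_le
      simp [hv] at this
    have hA : MeasurableSet[pastOf L X v]
        (aliveEvent L X E u s ∩ {ω | IsBorn (fun x => X x ω) v}) := by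
      have hβ : Measurable[pastOf L X v] fun ω => birthTime (fun x => L x ω) u :=
        measurable_pastOf_birthTime hsuf
      refine MeasurableSet.inter (MeasurableSet.inter (pastOf_mono hsuf _ hE) ?_)
        (measurableSet_pastOf_isBorn List.suffix_rfl)
      exact (measurableSet_pastOf_isBorn hsuf).inter
        ((@measurableSet_le _ _ _ _ _ (pastOf L X v) _ _ _ _ _ hβ measurable_const).inter
          (@measurableSet_lt _ _ _ _ _ (pastOf L X v) _ _ _ _ _ measurable_const
            (hβ.add (measurable_pastOf_lifetime hne))))
    have hm : Measurable[pastOf L X v]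
        ((aliveEvent L X E u s ∩ {ω | IsBorn (fun x => X x ω) v}).indicator (1 : Ω → ℝ≥0∞)) :=
      (@measurable_const _ _ _ (pastOf L X v) (1 : ℝ≥0∞)).indicator hA
    have key := h.lintegral_eq hb v hm (Set.Ioi i)
      (f := fun q => poissonWeight b k (t - (q.1 + q.2)))
      ((measurable_poissonWeight b k).comp (by fun_prop))
    simp_rw [← sub_sub, lintegral_poissonWeight_expMeasure hb] at key
    rw [ih j (k + 1)] at key
    calc _ = _ := lintegral_congr fun ω => ?_
      _ = _ := key
      _ = _ := by
        have : k + 1 + (j :: w).length = k + (i :: j :: w).length := by simp; omega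
        rw [this]
        simp only [lineWeight]
        ring
    have e : i :: j :: w ++ u = i :: v := rfl
    rw [e]
    classical
    simp only [Set.indicator_apply,
        Set.mem_inter_iff, Set.mem_ofPred_eq, Pi.one_apply, IsBorn, birthTime, Set.mem_Ioi, sub_sub]
    split_ifs <;> simp_all

theorem IsGenealogy.measure_alive_descendant [IsProbabilityMeasure P]
    (h : IsGenealogy P b p L X) (hb : 0 < b) {u : List ℕ} {E : Set Ω}
    (hE : MeasurableSet[pastOf L X u] E) {s t : ℝ} (hst : s ≤ t) (w : List ℕ) :
    P (aliveEvent L X E u s ∩ {ω | w ++ u ∈ aliveAt (fun x => L x ω) (fun x => X x ω) t}) =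
      lineWeight p w * poissonWeight b w.length (t - s) * P (aliveEvent L X E u s) := by
  cases w with
  | nil =>
    -- For `u` itself, survival to `t` already implies being alive at `s` once born by then; moving
    -- the birth condition into the event leaves one lifetime condition.
    have hE' : MeasurableSet[pastOf L X u] (E ∩ {ω | birthTime (fun x => L x ω) u ≤ s}) :=
      hE.inter (@measurableSet_le _ _ _ _ _ (pastOf L X u) _ _ _ _ _
        (measurable_pastOf_birthTime List.suffix_rfl) measurable_const)
    have e1 : aliveEvent L X E u s ∩
        {ω | [] ++ u ∈ aliveAt (fun x => L x ω) (fun x => X x ω) t} =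
        aliveEvent L X (E ∩ {ω | birthTime (fun x => L x ω) u ≤ s}) u t := by
      ext ω
      simp only [aliveEvent, aliveAt, Set.mem_inter_iff, Set.mem_ofPred_eq, List.nil_append]
      constructor
      · rintro ⟨⟨a, b, c, d⟩, -, e, f⟩
        exact ⟨⟨a, c⟩, b, e, f⟩
      · rintro ⟨⟨a, c⟩, b, e, f⟩
        exact ⟨⟨a, b, c, by linarith⟩, b, e, f⟩
    have e2 : aliveEvent L X E u s =
        aliveEvent L X (E ∩ {ω | birthTime (fun x => L x ω) u ≤ s}) u s := by
      ext ω
      simp only [aliveEvent, aliveAt, Set.mem_inter_iff, Set.mem_ofPred_eq]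
      tauto
    rw [e1, e2, h.measure_aliveEvent hb hE', h.measure_aliveEvent hb hE', lineWeight, one_mul,
      List.length_nil, ← lintegral_const_mul']
    · refine lintegral_congr fun ω => ?_
      by_cases hω : ω ∈ E ∩ {ω | birthTime (fun x => L x ω) u ≤ s} ∩
          {ω | IsBorn (fun x => X x ω) u}
      · rw [Set.indicator_of_mem hω, poissonWeight_zero_sub hω.1.2 hst]
        simp
      · rw [Set.indicator_of_notMem hω]
        simp
    · rw [poissonWeight_of_nonneg (by linarith)]
      exact ENNReal.ofReal_ne_top
  | cons i w =>
    set v := i :: w ++ u with hv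
    have hsuf : u <:+ v := List.suffix_append _ _
    have hne : ¬ v <:+ u := fun hvu => by
      have := hvu.length_le
      simp [hv] at this
    -- As `u` is a proper ancestor of `v`, its lifetime belongs to the past of `v`, so the whole
    -- event can play the role of `E` for `v`.
    have hA : MeasurableSet[pastOf L X v] (aliveEvent L X E u s) := by
      have hβ : Measurable[pastOf L X v] fun ω => birthTime (fun x => L x ω) u :=
        measurable_pastOf_birthTime hsuf
      refine MeasurableSet.inter (pastOf_mono hsuf _ hE) ?_
      exact (measurableSet_pastOf_isBorn hsuf).inter
        ((@measurableSet_le _ _ _ _ _ (pastOf L X v) _ _ _ _ _ hβ measurable_const).inter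
          (@measurableSet_lt _ _ _ _ _ (pastOf L X v) _ _ _ _ _ measurable_const
            (hβ.add (measurable_pastOf_lifetime hne))))
    have key := h.lintegral_descendant hb hE s t w i 0
    rw [zero_add] at key
    rw [← key]
    exact h.measure_aliveEvent hb hA t

/-! ### First passage and the submartingale inequality -/

/-- Among the times in `F`, the process `Y` is at level `a` or above for the first time at `s`. -/
def firstPassage {Ω : Type*} (Y : ℝ → Ω → ℝ≥0∞) (F : Finset ℝ) (a : ℝ≥0∞) (s : ℝ) : Set Ω :=
  {ω | a ≤ Y s ω ∧ ∀ r ∈ F, r < s → Y r ω < a}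

theorem measurableSet_firstPassage {Ω : Type*} {mΩ : MeasurableSpace Ω} {Y : ℝ → Ω → ℝ≥0∞}
    (hY : ∀ r, Measurable (Y r)) (F : Finset ℝ) (a : ℝ≥0∞) (s : ℝ) :
    MeasurableSet (firstPassage Y F a s) := by
  have : firstPassage Y F a s = {ω | a ≤ Y s ω} ∩ ⋂ r ∈ F, ⋂ (_ : r < s), {ω | Y r ω < a} := by
    ext ω
    simp [firstPassage]
  rw [this]
  exact (measurableSet_le measurable_const (hY s)).inter
    (F.measurableSet_biInter fun r _ => MeasurableSet.iInter fun _ =>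
      measurableSet_lt (hY r) measurable_const)

theorem pairwiseDisjoint_firstPassage {Ω : Type*} (Y : ℝ → Ω → ℝ≥0∞) (F : Finset ℝ) (a : ℝ≥0∞) :
    (F : Set ℝ).PairwiseDisjoint (firstPassage Y F a) := by
  intro s hs t ht hst
  refine Set.disjoint_left.2 fun ω h1 h2 => ?_
  rcases lt_or_gt_of_ne hst with h | h
  · exact absurd h1.1 (not_le.2 (h2.2 s hs h))
  · exact absurd h2.1 (not_le.2 (h1.2 t ht h))

theorem biUnion_firstPassage {Ω : Type*} (Y : ℝ → Ω → ℝ≥0∞) (F : Finset ℝ) (a : ℝ≥0∞) :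
    ⋃ s ∈ F, firstPassage Y F a s = {ω | ∃ s ∈ F, a ≤ Y s ω} := by
  ext ω
  simp only [Set.mem_iUnion, Set.mem_ofPred_eq, exists_prop]
  constructor
  · rintro ⟨s, hs, h⟩
    exact ⟨s, hs, h.1⟩
  · rintro ⟨s, hs, h⟩
    classical
    obtain ⟨t, ht, hmin⟩ := (F.filter fun r => a ≤ Y r ω).exists_min_image id
      ⟨s, Finset.mem_filter.2 ⟨hs, h⟩⟩
    rw [Finset.mem_filter] at ht
    refine ⟨t, ht.1, ht.2, fun r hr hrt => ?_⟩
    by_contra hc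
    have := hmin r (Finset.mem_filter.2 ⟨hr, not_lt.1 hc⟩)
    exact absurd hrt (not_lt.2 this)

/-- The submartingale property of the normalized population, on first passage events. -/
theorem IsGenealogy.mul_setLIntegral_population_le [IsProbabilityMeasure P]
    (h : IsGenealogy P b p L X) (hb : 0 < b) {μ : ℝ}
    (hμ : HasSum (fun k : ℕ => (k : ℝ) * (p k).toReal) μ) {s t : ℝ} (hst : s ≤ t)
    {Y : ℝ → Ω → ℝ≥0∞} (hY : Y = fun t ω => (population (fun x => L x ω) (fun x => X x ω) t : ℝ≥0∞))
    (F : Finset ℝ) (a : ℝ≥0∞) :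
    ENNReal.ofReal (Real.exp (b * (μ - 1) * (t - s))) * ∫⁻ ω in firstPassage Y F a s, Y s ω ∂P ≤
      ∫⁻ ω in firstPassage Y F a s, Y t ω ∂P := by
  set B := firstPassage Y F a s
  let al : ℝ → List ℕ → Set Ω := fun r u => {ω | u ∈ aliveAt (fun x => L x ω) (fun x => X x ω) r}
  have hal : ∀ r u, MeasurableSet (al r u) := fun r u =>
    measurableSet_mem_aliveAt h.measurable_lifetime h.measurable_offspring r u
  let E : List ℕ → Set Ω := fun u => firstPassage (fun r ω =>
    (population (prunedLifetime u (s + 1) fun x => L x ω)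
      (prunedOffspring u fun x => X x ω) r : ℝ≥0∞)) F a s
  have hE : ∀ u, MeasurableSet[pastOf L X u] (E u) := fun u =>
    measurableSet_firstPassage (mΩ := pastOf L X u)
      (fun r => measurable_pastOf_population_pruned u (s + 1) r) F a s
  -- The first passage event looks only at times up to `s`, where the true and pruned populations
  -- agree while `u` is alive.
  have hBE : ∀ u, (B ∩ al s u : Set Ω) =ᵐ[P] aliveEvent L X (E u) u s := by
    intro u
    filter_upwards [h.ae_nonneg] with ω hω
    refine propext (and_congr_left fun hu => ?_)
    have hpop : ∀ r, r ≤ s → Y r ω = (population (prunedLifetime u (s + 1) fun x => L x ω)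
      (prunedOffspring u fun x => X x ω) r : ℝ≥0∞) := fun r hr => by
        simp only [hY, population, aliveAt_pruned hω hr hu]
    change (a ≤ Y s ω ∧ ∀ r ∈ F, r < s → Y r ω < a) ↔ (a ≤ _ ∧ ∀ r ∈ F, r < s → _ < a)
    rw [hpop s le_rfl]
    refine and_congr_right fun _ => forall₂_congr fun r _ => forall_congr' fun hr => ?_
    rw [hpop r hr.le]
  have hlaw : ∀ u w, P (B ∩ al s u ∩ al t (w ++ u)) =
      lineWeight p w * poissonWeight b w.length (t - s) * P (B ∩ al s u) := by
    intro u w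
    rw [measure_congr (hBE u), measure_congr (s := B ∩ al s u ∩ al t (w ++ u))
      ((hBE u).inter (Filter.EventuallyEq.refl _ (al t (w ++ u))))]
    exact h.measure_alive_descendant hb (hE u) hst w
  have hs : ∫⁻ ω in B, Y s ω ∂P = ∑' u, P (B ∩ al s u) := by
    have hYs : Y s = fun ω => ∑' u, (al s u).indicator 1 ω := by
      rw [hY]
      exact funext fun ω => coe_population_eq_tsum _ _ s
    rw [hYs, lintegral_tsum (f := fun u => (al s u).indicator 1)
      fun u => (measurable_const.indicator (hal s u)).aemeasurable]
    refine tsum_congr fun u => ?_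
    rw [lintegral_indicator_one (hal s u), Measure.restrict_apply (hal s u), Set.inter_comm]
  calc ENNReal.ofReal (Real.exp (b * (μ - 1) * (t - s))) * ∫⁻ ω in B, Y s ω ∂P
      = ∑' u, ∑' w, P (B ∩ al s u ∩ al t (w ++ u)) := by
        simp_rw [hlaw, ENNReal.tsum_mul_right]
        rw [tsum_lineWeight_mul_poissonWeight hb hμ (sub_nonneg.2 hst), ENNReal.tsum_mul_left, hs]
    _ = ∑' u, ∑' w, ∫⁻ ω in B, (al s u).indicator 1 ω * (al t (w ++ u)).indicator 1 ω ∂P := by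
        refine tsum_congr fun u => tsum_congr fun w => ?_
        have : ∀ ω, ((al s u).indicator 1 ω * (al t (w ++ u)).indicator 1 ω : ℝ≥0∞) =
            (al s u ∩ al t (w ++ u)).indicator 1 ω := fun ω => by
          rw [Set.inter_indicator_one]; rfl
        simp_rw [this]
        rw [lintegral_indicator_one ((hal s u).inter (hal t _)),
          Measure.restrict_apply ((hal s u).inter (hal t _)), Set.inter_comm _ B, Set.inter_assoc]
    _ = ∫⁻ ω in B, ∑' u, ∑' w, (al s u).indicator 1 ω * (al t (w ++ u)).indicator 1 ω ∂P := by
        have hm : ∀ u w, Measurable fun ω =>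
            ((al s u).indicator 1 ω * (al t (w ++ u)).indicator 1 ω : ℝ≥0∞) := fun u w =>
          (measurable_const.indicator (hal s u)).mul (measurable_const.indicator (hal t _))
        rw [lintegral_tsum fun u => (Measurable.tsum fun w => hm u w).aemeasurable]
        exact tsum_congr fun u => (lintegral_tsum fun w => (hm u w).aemeasurable).symm
    _ ≤ ∫⁻ ω in B, Y t ω ∂P := by
        refine lintegral_mono_ae (ae_restrict_of_ae ?_)
        filter_upwards [h.ae_nonneg] with ω hω
        rw [hY]
        exact tsum_descendants_le_population (fun x => X x ω) hω s t

end Genealogy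

end GaltonWatson

/-! ### The maximal inequality -/

theorem mainTheorem9 {Ω : Type*} [MeasurableSpace Ω] (P : Measure Ω) [IsProbabilityMeasure P]
    (b : ℝ) (hb : 0 < b) (p : PMF ℕ) (μ : ℝ)
    (hμ : HasSum (fun k : ℕ => (k : ℝ) * (p k).toReal) μ) (hμ_lt : μ < 1)
    (m : ℝ) (hm : m = μ - 1)
    (Z : ℝ → Ω → ℕ∞) (hZ : GaltonWatson.IsProcess P b p Z)
    (α T : ℝ) (hα : 0 < α) (hT : 0 < T) :
    P {ω | ENNReal.ofReal α ≤ GaltonWatson.runningSup Z T ω} ≤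
      ENNReal.ofReal (α⁻¹ * Real.exp (-(b * m * T))) *
        ∫⁻ ω, {ω | ENNReal.ofReal α ≤ GaltonWatson.runningSup Z T ω}.indicator
          (fun ω => (Z T ω : ℝ≥0∞)) ω ∂P := by
  obtain ⟨L, X, h, hZ⟩ := hZ
  let Y : ℝ → Ω → ℝ≥0∞ := fun t ω =>
    GaltonWatson.population (fun x => L x ω) (fun x => X x ω) t
  have hYm : ∀ r, Measurable (Y r) := fun r =>
    GaltonWatson.measurable_population h.measurable_lifetime h.measurable_offspring r
  set a := ENNReal.ofReal α with ha
  let D := GaltonWatson.gridTimes T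
  have : Countable D := (GaltonWatson.countable_gridTimes T).to_subtype
  let A : Finset D → Set Ω := fun F => {ω | ∃ s ∈ F.map (Function.Embedding.subtype _), a ≤ Y s ω}
  have hA : {ω | a ≤ GaltonWatson.runningSup Z T ω} = ⋃ F, A F := by
    ext ω
    have hsup : GaltonWatson.runningSup Z T ω = ⨆ s ∈ Set.Icc (0 : ℝ) T, Y s ω :=
      iSup_congr fun s => iSup_congr fun hs => by rw [hZ s hs.1 ω]
    rw [Set.mem_ofPred_eq, hsup, GaltonWatson.ofReal_le_iSup_population_iff _ _ hα hT.le,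
      Set.mem_iUnion]
    constructor
    · rintro ⟨q, hq, hqa⟩
      exact ⟨{⟨q, hq⟩}, q, by simp, hqa⟩
    · rintro ⟨F, s, hs, hsa⟩
      obtain ⟨q, -, rfl⟩ := Finset.mem_map.1 hs
      exact ⟨q, q.2, hsa⟩
  have hAm : ∀ F, MeasurableSet (A F) := fun F => by
    have : A F = ⋃ s ∈ F.map (Function.Embedding.subtype _), {ω | a ≤ Y s ω} := by
      ext ω; simp [A]
    rw [this]
    exact Finset.measurableSet_biUnion _ fun s _ => measurableSet_le measurable_const (hYm s)
  have hdir : Directed (· ⊆ ·) A := by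
    refine Monotone.directed_le (f := A) fun F G hFG ω => ?_
    rintro ⟨s, hs, hsa⟩
    exact ⟨s, Finset.map_subset_map.2 hFG hs, hsa⟩
  have hZT : (fun ω => (Z T ω : ℝ≥0∞)) = Y T := funext fun ω => by rw [hZ T hT.le ω]
  -- Continuity from below along finite subsets of the grid leaves a bound for each finite subset.
  rw [hA, hdir.measure_iUnion, hZT, lintegral_indicator (MeasurableSet.iUnion hAm)]
  refine iSup_le fun F => ?_
  refine le_trans ?_ (mul_le_mul_right (lintegral_mono_set (Set.subset_iUnion A F)) _)
  set G := F.map (Function.Embedding.subtype (· ∈ D))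
  have hGD : ∀ s ∈ G, s ∈ Set.Icc 0 T := fun s hs => by
    obtain ⟨q, -, rfl⟩ := Finset.mem_map.1 hs
    exact GaltonWatson.gridTimes_subset hT.le q.2
  let B := GaltonWatson.firstPassage Y G a
  have hBm : ∀ s, MeasurableSet (B s) := GaltonWatson.measurableSet_firstPassage hYm G a
  have hdisj : (G : Set ℝ).PairwiseDisjoint B := GaltonWatson.pairwiseDisjoint_firstPassage Y G a
  have hAB : A F = ⋃ s ∈ G, B s := (GaltonWatson.biUnion_firstPassage Y G a).symm
  rw [hAB, measure_biUnion_finset hdisj fun s _ => hBm s,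
    lintegral_biUnion_finset hdisj fun s _ => hBm s, Finset.mul_sum]
  refine Finset.sum_le_sum fun s hs => ?_
  have hsT := hGD s hs
  have h1 : a * P (B s) ≤ ∫⁻ ω in B s, Y s ω ∂P := by
    rw [← setLIntegral_const]
    exact setLIntegral_mono (hYm s) fun ω hω => hω.1
  have h2 := h.mul_setLIntegral_population_le hb hμ hsT.2 (Y := Y) rfl G a
  -- Subcriticality enters here only: the combined exponent is $b(1-\mu)s\ge 0$.
  have hexp : 1 ≤ Real.exp (-(b * m * T)) * Real.exp (b * (μ - 1) * (T - s)) := by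
    rw [← Real.exp_add, Real.one_le_exp_iff, hm]
    have : 0 ≤ b * (1 - μ) * s := mul_nonneg (mul_nonneg hb.le (by linarith)) hsT.1
    linarith
  have hainv : ENNReal.ofReal α⁻¹ * a = 1 := by
    rw [ha, ← ENNReal.ofReal_mul (by positivity), inv_mul_cancel₀ hα.ne', ENNReal.ofReal_one]
  calc P (B s) = ENNReal.ofReal α⁻¹ * (1 * (a * P (B s))) := by
        rw [one_mul, ← mul_assoc, hainv, one_mul]
    _ ≤ ENNReal.ofReal α⁻¹ * (ENNReal.ofReal (Real.exp (-(b * m * T)) *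
          Real.exp (b * (μ - 1) * (T - s))) * ∫⁻ ω in B s, Y s ω ∂P) := by
        gcongr
        exact ENNReal.one_le_ofReal.2 hexp
    _ = ENNReal.ofReal (α⁻¹ * Real.exp (-(b * m * T))) *
          (ENNReal.ofReal (Real.exp (b * (μ - 1) * (T - s))) * ∫⁻ ω in B s, Y s ω ∂P) := by
        rw [ENNReal.ofReal_mul (by positivity), ENNReal.ofReal_mul (by positivity)]
        ring
    _ ≤ _ := by gcongr
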